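/- Let $0<\underline\theta<\overline\theta$, $\Theta=[\underline\theta,\overline\theta]$, $c>0$, $\overline q>0$, $\alpha\in[0,1)$, and let the inverse demand function $P:[0,\overline q]\to\mathbb R_+$ be continuous and strictly decreasing with $P(\overline q)=0$. Write $V(q)=\int_0^q P(z)\,dz$, and assume that $P^{-1}(\overline\theta)$ exists and that $V(q)-c-\overline\theta q>0$ at $q=P^{-1}(\overline\theta)$. A monopolist of privately known marginal cost $\theta\in\Theta$ produces $q>0$ at total cost $c+\theta q$. Let $q_e(\theta)=P^{-1}(\theta)$ be the efficient quantity and let $\hat q$ be the unique solution in $[0,\overline q]$ of $V(q)-qP(q)=c$. A mechanism $M=(r,q,s)$ consists of functions $r:\Theta\to[0,1]$ (probability of operation), $q:\Theta\to[0,\overline q]$ (quantity) and $s:\Theta\to\mathbb R$ (subsidy) with $q(\theta)=0$ if and only if $r(\theta)=0$. Let $u(\theta)=[q(\theta)P(q(\theta))-c-\theta q(\theta)+s(\theta)]\,r(\theta)$. The mechanism is IC if $u(\theta)\ge[q(\theta')P(q(\theta'))-c-\theta q(\theta')+s(\theta')]\,r(\theta')$ for all $\theta,\theta'\in\Theta$,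 IR if $u(\theta)\ge0$ for all $\theta\in\Theta$, and deterministic if $r(\theta)\in\{0,1\}$ for all $\theta\in\Theta$. The regulator's surplus is $$\mathrm{RS}_\alpha(\theta,M)=\big(V(q(\theta))-q(\theta)P(q(\theta))-s(\theta)\big)r(\theta)+\alpha u(\theta),$$ and for a prior $G$ on $\Theta$ its expectation is $\mathrm{RS}_\alpha(M,G)=\int_\Theta \mathrm{RS}_\alpha(\theta,M)\,dG(\theta)$. An IC and IR mechanism (with $G$-integrable surplus) is optimal for $G$ if no IC and IR mechanism (with $G$-integrable surplus) has a larger expected surplus. Then for every prior $G$ (Borel probability measure on $\Theta$) there exists a deterministic mechanism $M=(r,q,s)$ that is optimal for $G$, satisfies downward distortion, that is, $q(\theta)\le q_e(\theta)$ for all $\theta\in\Theta$ with equality at $\underline\theta$, and has a quantity floor, that is, $q(\theta)\ge\hat q$ whenever $q(\theta)>0$. -/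

import Mathlib

open MeasureTheory

noncomputable section

/-- The primitives of the regulated market, with the standing assumptions on them.
Only the values of the inverse demand function `P` on `[0, qbar]` are ever used. -/
structure Market where
  /-- fixed cost, incurred only when a positive quantity is produced -/
  c : ℝ
  /-- lowest marginal cost -/
  θlo : ℝ
  /-- highest marginal cost -/
  θhi : ℝ
  /-- the quantity at which the inverse demand vanishes -/
  qbar : ℝ
  /-- inverse demand function -/
  P : ℝ → ℝ
  c_pos : 0 < c
  θlo_pos : 0 < θlo
  θlo_lt_θhi : θlo < θhi
  qbar_pos : 0 < qbar
  P_strictAnti : StrictAntiOn P (Set.Icc 0 qbar)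
  P_cont : ContinuousOn P (Set.Icc 0 qbar)
  P_qbar : P qbar = 0
  /-- Operating the highest-cost type at its efficient quantity `P⁻¹(θhi)` gives a positive
  total surplus. -/
  surplus_pos : ∃ q ∈ Set.Icc (0 : ℝ) qbar, P q = θhi ∧ 0 < (∫ z in (0 : ℝ)..q, P z) - c - θhi * q

namespace Market

variable (E : Market)

/-- The type space `Θ`. -/
abbrev Types : Set ℝ := Set.Icc E.θlo E.θhi

/-- Total value to the consumers of the quantity `q`. -/
def V (q : ℝ) : ℝ := ∫ z in (0 : ℝ)..q, E.P z

theorem intervalIntegrable_P {a b : ℝ} (ha : a ∈ Set.Icc 0 E.qbar) (hb : b ∈ Set.Icc 0 E.qbar) :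
    IntervalIntegrable E.P volume a b :=
  (E.P_cont.mono (Set.uIcc_subset_Icc ha hb)).intervalIntegrable

/-- Every marginal cost has exactly one efficient quantity. -/
theorem existsUnique_efficientQuantity (θ : E.Types) :
    ∃! q : ℝ, q ∈ Set.Icc 0 E.qbar ∧ E.P q = θ := by
  obtain ⟨q₁, hq₁, hP, -⟩ := E.surplus_pos
  have hlo := E.θlo_pos
  have hθ := θ.2
  have hsub : Set.Icc q₁ E.qbar ⊆ Set.Icc 0 E.qbar := Set.Icc_subset_Icc_left hq₁.1
  obtain ⟨q, hq, hqP⟩ := intermediate_value_Icc' hq₁.2 (E.P_cont.mono hsub)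
    (show (θ : ℝ) ∈ Set.Icc (E.P E.qbar) (E.P q₁) by
      rw [E.P_qbar, hP]; exact ⟨hlo.le.trans hθ.1, hθ.2⟩)
  exact ⟨q, ⟨hsub hq, hqP⟩, fun y hy => E.P_strictAnti.injOn hy.1 (hsub hq) (hy.2.trans hqP.symm)⟩

/-- The efficient quantity rule `q_e`, determined by `P (q_e θ) = θ`. -/
def qe (θ : E.Types) : ℝ := (E.existsUnique_efficientQuantity θ).choose

theorem qe_spec (θ : E.Types) : E.qe θ ∈ Set.Icc 0 E.qbar ∧ E.P (E.qe θ) = θ :=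
  (E.existsUnique_efficientQuantity θ).choose_spec.1

/-- The equation `V q - q P(q) = c` has exactly one solution. -/
theorem existsUnique_quantityFloor :
    ∃! q : ℝ, q ∈ Set.Icc 0 E.qbar ∧ E.V q - q * E.P q = E.c := by
  have hc := E.c_pos
  have hb := E.qbar_pos
  have h0 : (0 : ℝ) ∈ Set.Icc 0 E.qbar := ⟨le_rfl, hb.le⟩
  have hqb : E.qbar ∈ Set.Icc 0 E.qbar := ⟨hb.le, le_rfl⟩
  -- `P` is at least `P b` on `[a, b]`.
  have key : ∀ a ∈ Set.Icc 0 E.qbar, ∀ b ∈ Set.Icc 0 E.qbar, a ≤ b →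
      E.V a + (b - a) * E.P b ≤ E.V b := by
    intro a ha b hb' hab
    have h1 : E.V a + ∫ z in a..b, E.P z = E.V b :=
      intervalIntegral.integral_add_adjacent_intervals (E.intervalIntegrable_P h0 ha)
        (E.intervalIntegrable_P ha hb')
    have h2 : ∫ z in a..b, E.P b ≤ ∫ z in a..b, E.P z :=
      intervalIntegral.integral_mono_on hab intervalIntegrable_const
        (E.intervalIntegrable_P ha hb') fun x hx =>
          E.P_strictAnti.antitoneOn ⟨ha.1.trans hx.1, hx.2.trans hb'.2⟩ hb' hx.2
    rw [intervalIntegral.integral_const, smul_eq_mul] at h2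
    linarith
  have hV0 : E.V 0 = 0 := intervalIntegral.integral_same
  have lt_of : ∀ a ∈ Set.Icc 0 E.qbar, ∀ b ∈ Set.Icc 0 E.qbar, 0 < a → a < b →
      E.V a - a * E.P a < E.V b - b * E.P b := by
    intro a ha b hb' ha0 hab
    have h1 := key a ha b hb' hab.le
    have h2 := mul_lt_mul_of_pos_left (E.P_strictAnti ha hb' hab) ha0
    linarith
  have hVc : ContinuousOn E.V (Set.Icc 0 E.qbar) := by
    have := intervalIntegral.continuousOn_primitive_interval (μ := volume) (f := E.P)
      (a := 0) (b := E.qbar) (by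
        rw [Set.uIcc_of_le hb.le]; exact E.P_cont.integrableOn_Icc)
    rwa [Set.uIcc_of_le hb.le] at this
  have hcont : ContinuousOn (fun q => E.V q - q * E.P q) (Set.Icc 0 E.qbar) :=
    hVc.sub (continuousOn_id.mul E.P_cont)
  obtain ⟨q₁, hq₁, hP, hpos⟩ := E.surplus_pos
  have hθhi : 0 < E.θhi := E.θlo_pos.trans E.θlo_lt_θhi
  have hVq : E.c ≤ E.V E.qbar := by
    have h1 := key q₁ hq₁ _ hqb hq₁.2
    have h2 := mul_nonneg hθhi.le hq₁.1
    rw [E.P_qbar] at h1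
    change 0 < E.V q₁ - E.c - E.θhi * q₁ at hpos
    linarith
  obtain ⟨q, hq, hqe⟩ := intermediate_value_Icc hb.le hcont
    (show E.c ∈ Set.Icc _ _ from ⟨by simp [hV0, hc.le], by simpa [E.P_qbar] using hVq⟩)
  have pos_of : ∀ y, y ∈ Set.Icc 0 E.qbar → E.V y - y * E.P y = E.c → 0 < y := by
    intro y hy hye
    rcases hy.1.eq_or_lt with h | h
    · subst h; rw [hV0] at hye; linarith
    · exact h
  refine ⟨q, ⟨hq, hqe⟩, fun y hy => ?_⟩
  have hq0 := pos_of q hq hqe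
  have hy0 := pos_of y hy.1 hy.2
  have hye := hy.2
  simp only at hqe
  rcases lt_trichotomy y q with h | h | h
  · have := lt_of y hy.1 q hq hy0 h; linarith
  · exact h
  · have := lt_of q hq y hy.1 hq0 h; linarith

/-- The quantity floor `q̂`, determined by `V q̂ - q̂ P(q̂) = c`. -/
def qhat : ℝ := E.existsUnique_quantityFloor.choose

theorem qhat_spec : E.qhat ∈ Set.Icc 0 E.qbar ∧ E.V E.qhat - E.qhat * E.P E.qhat = E.c :=
  E.existsUnique_quantityFloor.choose_spec.1

/-- A direct regulatory mechanism: the probability `r` of being allowed to operate, the quantity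
rule `q`, and the subsidy rule `s` (paid if the monopolist operates), as functions of the reported
marginal cost. -/
structure Mechanism where
  r : E.Types → ℝ
  q : E.Types → ℝ
  s : E.Types → ℝ
  r_mem : ∀ θ, r θ ∈ Set.Icc (0 : ℝ) 1
  q_mem : ∀ θ, q θ ∈ Set.Icc 0 E.qbar
  q_eq_zero_iff : ∀ θ, q θ = 0 ↔ r θ = 0

namespace Mechanism

variable {E} (M : E.Mechanism)

/-- Expected payoff of a monopolist of type `θ` who reports `θ'`. -/
def payoff (θ θ' : E.Types) : ℝ :=
  (M.q θ' * E.P (M.q θ') - E.c - θ * M.q θ' + M.s θ') * M.r θ'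

/-- Payoff of a truthful monopolist. -/
def u (θ : E.Types) : ℝ := M.payoff θ θ

/-- Incentive compatibility. -/
def IC : Prop := ∀ θ θ' : E.Types, M.payoff θ θ' ≤ M.u θ

/-- Individual rationality. -/
def IR : Prop := ∀ θ : E.Types, 0 ≤ M.u θ

/-- Consumer surplus. -/
def CS (θ : E.Types) : ℝ := (E.V (M.q θ) - M.q θ * E.P (M.q θ) - M.s θ) * M.r θ

/-- The regulator's surplus, with weight `α` on the monopolist's payoff. -/
def RS (α : ℝ) (θ : E.Types) : ℝ := M.CS θ + α * M.u θ

/-- The regulator's expected surplus under the prior `G`. -/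
def expectedRS (α : ℝ) (G : Measure E.Types) : ℝ := ∫ θ, M.RS α θ ∂G

/-- `M` is optimal for the prior `G`: it is IC and IR, and no IC and IR mechanism gives a higher
expected surplus. The surplus of an IC and IR mechanism is bounded, so integrability only says that
the expected surplus is a meaningful quantity (that the surplus is a measurable function of the
type, up to null sets). -/
def IsOptimal (α : ℝ) (G : Measure E.Types) : Prop :=
  M.IC ∧ M.IR ∧ Integrable (M.RS α) G ∧
    ∀ M' : E.Mechanism, M'.IC → M'.IR → Integrable (M'.RS α) G →
      M'.expectedRS α G ≤ M.expectedRS α G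

/-- The operation decision is never random. -/
def Deterministic : Prop := ∀ θ, M.r θ = 0 ∨ M.r θ = 1

/-- Downward distortion: the quantity is at most the efficient one, with equality at the lowest
marginal cost. -/
def DownwardDistortion : Prop :=
  (∀ θ, M.q θ ≤ E.qe θ) ∧ ∀ θ : E.Types, (θ : ℝ) = E.θlo → M.q θ = E.qe θ

/-- Whenever a positive quantity is produced, it is at least `q̂`. -/
def HasQuantityFloor : Prop := ∀ θ, 0 < M.q θ → E.qhat ≤ M.q θ

end Mechanism

end Market

end

noncomputable section

open Filter Topology

/-! An IC and IR mechanism matters only through its expected quantity `x = q * r`, which is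
antitone. Type `θ` must earn at least `rent x θ`, the integral of `x` over higher types
(`IC.rent_le_u`). Operating surplus net of the fixed cost is at most `envelope x`, the concave
envelope of `0` at quantity zero and `V - c` elsewhere. The tangent to `V - c` at `q̂` passes
through the origin, so the envelope is linear up to `q̂` and equals `V - c` beyond. Hence
`objective` bounds the surplus (`RS_le_objective`), and schedules avoiding `(0, q̂)` attain it
deterministically (`ofSchedule_RS`).

The expected objective is linear in `min x q̂`, which is an average over `s` in `(0, q̂)` of the
threshold rules `q̂ · 1{s < x}`. Some threshold does at least as well as the average, and
substituting it leaves the part of `x` above `q̂` unchanged (`exists_isFloored`). Capping at `qe`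
then raises surplus and lowers rents (`exists_isRegular`). A best schedule of this kind exists by
Helly selection and dominated convergence (`exists_isRegular_maximizer`). -/

/-! ### Helly selection -/

/-- A countable product of intervals is compact and first countable, hence sequentially compact;
this replaces a diagonal argument. -/
theorem exists_subseq_tendsto_on_countable {β : Type*} {D : Set β} (hD : D.Countable) {a b : ℝ}
    (x : ℕ → β → ℝ) (hx : ∀ n t, x n t ∈ Set.Icc a b) :
    ∃ φ : ℕ → ℕ, StrictMono φ ∧ ∀ t ∈ D, ∃ l, Tendsto (fun n => x (φ n) t) atTop (𝓝 l) := by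
  have := hD.to_subtype
  have hK : IsCompact (Set.pi Set.univ fun _ : D => Set.Icc a b) :=
    isCompact_univ_pi fun _ => isCompact_Icc
  obtain ⟨l, -, φ, hφ, hl⟩ := hK.tendsto_subseq (x := fun n (t : D) => x n t)
    fun n t _ => hx n t
  exact ⟨φ, hφ, fun t ht => ⟨l ⟨t, ht⟩, (tendsto_pi_nhds.1 hl) ⟨t, ht⟩⟩⟩

/-- Helly's selection theorem for uniformly bounded sequences of antitone functions. -/
theorem exists_subseq_tendsto_of_antitone {a b : ℝ} (x : ℕ → ℝ → ℝ) (hanti : ∀ n, Antitone (x n))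
    (hx : ∀ n t, x n t ∈ Set.Icc a b) :
    ∃ φ : ℕ → ℕ, StrictMono φ ∧ ∀ t, ∃ l, Tendsto (fun n => x (φ n) t) atTop (𝓝 l) := by
  obtain ⟨φ, hφ, hl⟩ := exists_subseq_tendsto_on_countable
    (Set.countable_range ((↑) : ℚ → ℝ)) x hx
  -- The limsup is defined and antitone everywhere, before any convergence off the rationals is
  -- known.
  set L : ℝ → ℝ := fun t => limsup (fun n => x (φ n) t) atTop
  have hrat : ∀ d : ℚ, Tendsto (fun n => x (φ n) d) atTop (𝓝 (L d)) := by
    intro d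
    obtain ⟨l, h⟩ := hl d ⟨d, rfl⟩
    rwa [show L d = l from h.limsup_eq]
  have hLanti : Antitone L := by
    intro s t hst
    refine limsup_le_limsup (Eventually.of_forall fun n => hanti _ hst) ?_ ?_
    · exact (isBoundedUnder_of ⟨a, fun n => (hx (φ n) t).1⟩ :
        IsBoundedUnder (· ≥ ·) atTop _).isCoboundedUnder_le
    · exact isBoundedUnder_of ⟨b, fun n => (hx (φ n) s).2⟩
  -- At a continuity point, monotonicity squeezes the sequence between its values at nearby
  -- rationals.
  have hcont : ∀ t, ContinuousAt L t → Tendsto (fun n => x (φ n) t) atTop (𝓝 (L t)) := by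
    intro t ht
    refine tendsto_order.2 ⟨fun y hy => ?_, fun y hy => ?_⟩
    · obtain ⟨u, v, huv, hsub⟩ := mem_nhds_iff_exists_Ioo_subset.1 (ht.eventually (lt_mem_nhds hy))
      obtain ⟨d, hd, hd'⟩ := exists_rat_btwn huv.2
      filter_upwards [(hrat d).eventually (lt_mem_nhds (hsub ⟨huv.1.trans hd, hd'⟩))] with n hn
      exact hn.trans_le (hanti _ hd.le)
    · obtain ⟨u, v, huv, hsub⟩ := mem_nhds_iff_exists_Ioo_subset.1 (ht.eventually (gt_mem_nhds hy))
      obtain ⟨d, hd, hd'⟩ := exists_rat_btwn huv.1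
      filter_upwards [(hrat d).eventually (gt_mem_nhds (hsub ⟨hd, hd'.trans huv.2⟩))] with n hn
      exact (hanti _ hd'.le).trans_lt hn
  -- The discontinuities of the antitone `L` are countable, so a second extraction handles them.
  obtain ⟨ψ, hψ, hl'⟩ := exists_subseq_tendsto_on_countable hLanti.countable_not_continuousAt
    (fun n => x (φ n)) (fun n => hx (φ n))
  refine ⟨φ ∘ ψ, hφ.comp hψ, fun t => ?_⟩
  by_cases ht : ContinuousAt L t
  · exact ⟨L t, (hcont t ht).comp hψ.tendsto_atTop⟩
  · exact hl' t ht

/-! ### Comparison of increments -/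

/-- A function whose decrease over every subinterval is bounded by the length times the decrease
of an auxiliary function does not increase. -/
theorem le_of_forall_sub_le_mul {F g : ℝ → ℝ} {a b : ℝ} (hab : a ≤ b)
    (h : ∀ s ∈ Set.Icc a b, ∀ t ∈ Set.Icc a b, s ≤ t → F t - F s ≤ (t - s) * (g s - g t)) :
    F b ≤ F a := by
  -- Over `n + 1` equal pieces the bounds on the increments telescope in `g`, leaving an error of
  -- order `1 / (n + 1)`.
  have key : ∀ n : ℕ, F b - F a ≤ (b - a) * (g a - g b) * (1 / ((n : ℝ) + 1)) := by
    intro n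
    have hn : (0 : ℝ) < (n : ℝ) + 1 := by positivity
    set p : ℕ → ℝ := fun i => a + i * ((b - a) / (n + 1)) with hp
    have hstep : 0 ≤ (b - a) / ((n : ℝ) + 1) := div_nonneg (sub_nonneg.2 hab) hn.le
    have hmem : ∀ i ≤ n + 1, p i ∈ Set.Icc a b := by
      intro i hi
      have hi' : (i : ℝ) ≤ (n : ℝ) + 1 := by exact_mod_cast hi
      refine ⟨le_add_of_nonneg_right (mul_nonneg i.cast_nonneg hstep), ?_⟩
      have := mul_le_mul_of_nonneg_right hi' hstep
      rw [mul_div_cancel₀ _ hn.ne'] at this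
      simp only [hp]; linarith
    have hdiff : ∀ i, p (i + 1) - p i = (b - a) / (n + 1) := by
      intro i; simp only [hp]; push_cast; ring
    have hsum : ∑ i ∈ Finset.range (n + 1), (F (p (i + 1)) - F (p i)) ≤
        ∑ i ∈ Finset.range (n + 1), ((b - a) / (n + 1)) * (g (p i) - g (p (i + 1))) := by
      refine Finset.sum_le_sum fun i hi => ?_
      have hi' := Finset.mem_range.1 hi
      have := h _ (hmem i hi'.le) _ (hmem (i + 1) hi') (by linarith [hdiff i])
      rwa [hdiff] at this
    rw [Finset.sum_range_sub (fun i => F (p i)), ← Finset.mul_sum,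
      Finset.sum_range_sub' (fun i => g (p i))] at hsum
    have h0 : p 0 = a := by simp [hp]
    have h1 : p (n + 1) = b := by simp only [hp]; push_cast; field_simp; ring
    rw [h0, h1] at hsum
    refine hsum.trans_eq (by ring)
  have hlim := tendsto_one_div_add_atTop_nhds_zero_nat (𝕜 := ℝ).const_mul ((b - a) * (g a - g b))
  rw [mul_zero] at hlim
  exact sub_nonpos.1 (ge_of_tendsto' hlim key)

/-! ### Averaging over thresholds -/

section Threshold

variable {T : Type*} [MeasurableSpace T]

theorem integrable_threshold (μ : Measure T) [IsFiniteMeasure μ] {w x : T → ℝ} {C : ℝ}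
    (hw : Measurable w) (hC : ∀ t, |w t| ≤ C) (hx : Measurable x) (K : ℝ) :
    Integrable (Function.uncurry fun (s : ℝ) (t : T) => w t * if s < x t then 1 else 0)
      ((volume.restrict (Set.Ioo 0 K)).prod μ) := by
  have hset : MeasurableSet {p : ℝ × T | p.1 < x p.2} :=
    measurableSet_lt measurable_fst (hx.comp measurable_snd)
  refine Integrable.of_bound (C := C) ?_ (Eventually.of_forall fun p => ?_)
  · exact ((hw.comp measurable_snd).mul
      (Measurable.ite hset measurable_const measurable_const)).aestronglyMeasurable
  · have := hC p.2
    have h0 := (abs_nonneg _).trans this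
    simp only [Function.uncurry, Real.norm_eq_abs, abs_mul]
    split_ifs <;> simp [this, h0]

theorem integral_threshold (μ : Measure T) [IsFiniteMeasure μ] {w x : T → ℝ} {C : ℝ}
    (hw : Measurable w) (hC : ∀ t, |w t| ≤ C) (hx : Measurable x) (hx0 : ∀ t, 0 ≤ x t)
    {K : ℝ} (hK : 0 ≤ K) :
    ∫ s in Set.Ioo 0 K, ∫ t, w t * (if s < x t then 1 else 0) ∂μ = ∫ t, w t * min (x t) K ∂μ := by
  rw [integral_integral_swap (integrable_threshold μ hw hC hx K)]
  refine integral_congr_ae (Eventually.of_forall fun t => ?_)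
  have hind : (fun s : ℝ => if s < x t then (1 : ℝ) else 0) = (Set.Iio (x t)).indicator 1 := by
    funext s; simp [Set.indicator_apply]
  simp only
  rw [integral_const_mul, hind, integral_indicator_one measurableSet_Iio,
    measureReal_restrict_apply measurableSet_Iio, Set.Iio_inter_Ioo, Real.volume_real_Ioo_of_le,
    sub_zero]
  exact le_min (hx0 t) hK

/-- Since `min x K` is the integral of `1{s < x}` over `s` in `(0, K)`, the left side is the average
over `s` of the right side, and some `s` reaches the average. Two measures are needed: the prior
weighs surplus, Lebesgue measure weighs rents. -/
theorem exists_threshold_ge (μ ν : Measure T) [IsFiniteMeasure μ] [IsFiniteMeasure ν]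
    {w v x : T → ℝ} {C D : ℝ} (hw : Measurable w) (hC : ∀ t, |w t| ≤ C)
    (hv : Measurable v) (hD : ∀ t, |v t| ≤ D) (hx : Measurable x) (hx0 : ∀ t, 0 ≤ x t)
    {K : ℝ} (hK : 0 < K) :
    ∃ s ∈ Set.Ioo 0 K, (∫ t, w t * min (x t) K ∂μ) + ∫ t, v t * min (x t) K ∂ν ≤
      (∫ t, w t * (if s < x t then K else 0) ∂μ) + ∫ t, v t * (if s < x t then K else 0) ∂ν := by
  have h1 := (integrable_threshold μ hw hC hx K).integral_prod_left
  have h2 := (integrable_threshold ν hv hD hx K).integral_prod_left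
  simp only [Function.uncurry] at h1 h2
  have hvol : volume (Set.Ioo 0 K) ≠ 0 := by simp [hK]
  have hvol' : volume (Set.Ioo 0 K) ≠ ⊤ := by simp
  obtain ⟨s, hs, hle⟩ := exists_setAverage_le hvol hvol' (h1.add h2)
  refine ⟨s, hs, ?_⟩
  simp only [Pi.add_apply] at hle
  rw [setAverage_eq, integral_add h1 h2, integral_threshold μ hw hC hx hx0 hK.le,
    integral_threshold ν hv hD hx hx0 hK.le, Real.volume_real_Ioo_of_le hK.le, sub_zero,
    smul_eq_mul, inv_mul_le_iff₀ hK, mul_add, ← integral_const_mul, ← integral_const_mul] at hle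
  refine hle.trans_eq ?_
  congr 1 <;> refine integral_congr_ae (Eventually.of_forall fun t => ?_) <;>
    simp only <;> split_ifs <;> ring

end Threshold

namespace Market

variable (E : Market)

/-! ### Concavity of consumer value, efficient quantity and floor -/

theorem zero_mem : (0 : ℝ) ∈ Set.Icc 0 E.qbar := ⟨le_rfl, E.qbar_pos.le⟩

theorem P_nonneg {q : ℝ} (hq : q ∈ Set.Icc 0 E.qbar) : 0 ≤ E.P q := by
  have := E.P_strictAnti.antitoneOn hq ⟨E.qbar_pos.le, le_rfl⟩ hq.2
  rwa [E.P_qbar] at this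

theorem V_sub_V {a b : ℝ} (ha : a ∈ Set.Icc 0 E.qbar) (hb : b ∈ Set.Icc 0 E.qbar) :
    E.V b - E.V a = ∫ z in a..b, E.P z :=
  sub_eq_of_eq_add' (intervalIntegral.integral_add_adjacent_intervals
    (E.intervalIntegrable_P E.zero_mem ha) (E.intervalIntegrable_P ha hb)).symm

/-- The gross consumer value lies below its tangents. -/
theorem V_le_tangent {q y : ℝ} (hq : q ∈ Set.Icc 0 E.qbar) (hy : y ∈ Set.Icc 0 E.qbar) :
    E.V y ≤ E.V q + E.P q * (y - q) := by
  rcases le_total q y with h | h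
  · have h1 := E.V_sub_V hq hy
    have h2 : ∫ z in q..y, E.P z ≤ ∫ z in q..y, E.P q :=
      intervalIntegral.integral_mono_on h (E.intervalIntegrable_P hq hy) intervalIntegrable_const
        fun z hz => E.P_strictAnti.antitoneOn hq ⟨hq.1.trans hz.1, hz.2.trans hy.2⟩ hz.1
    rw [intervalIntegral.integral_const, smul_eq_mul] at h2
    linarith
  · have h1 := E.V_sub_V hy hq
    have h2 : ∫ z in y..q, E.P q ≤ ∫ z in y..q, E.P z :=
      intervalIntegral.integral_mono_on h intervalIntegrable_const (E.intervalIntegrable_P hy hq)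
        fun z hz => E.P_strictAnti.antitoneOn ⟨hy.1.trans hz.1, hz.2.trans hq.2⟩ hq hz.2
    rw [intervalIntegral.integral_const, smul_eq_mul] at h2
    linarith

theorem V_mono {a b : ℝ} (ha : a ∈ Set.Icc 0 E.qbar) (hb : b ∈ Set.Icc 0 E.qbar) (hab : a ≤ b) :
    E.V a ≤ E.V b := by
  have := E.V_le_tangent hb ha
  nlinarith [mul_nonneg (E.P_nonneg hb) (sub_nonneg.2 hab)]

theorem V_continuousOn : ContinuousOn E.V (Set.Icc 0 E.qbar) := by
  have := intervalIntegral.continuousOn_primitive_interval (μ := volume) (f := E.P)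
    (a := 0) (b := E.qbar) (by
      rw [Set.uIcc_of_le E.qbar_pos.le]; exact E.P_cont.integrableOn_Icc)
  rwa [Set.uIcc_of_le E.qbar_pos.le] at this

theorem consumerSurplus_mono {a b : ℝ} (ha : a ∈ Set.Icc 0 E.qbar) (hb : b ∈ Set.Icc 0 E.qbar)
    (hab : a ≤ b) : E.V a - a * E.P a ≤ E.V b - b * E.P b := by
  have h1 := E.V_le_tangent hb ha
  have h2 := mul_le_mul_of_nonneg_left (E.P_strictAnti.antitoneOn ha hb hab) ha.1
  linarith

theorem qhat_mem : E.qhat ∈ Set.Icc 0 E.qbar := E.qhat_spec.1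

theorem qhat_pos : 0 < E.qhat := by
  refine E.qhat_mem.1.lt_of_ne fun h => ?_
  have h1 := E.qhat_spec.2
  have h2 := E.c_pos
  rw [← h, show E.V 0 = 0 from intervalIntegral.integral_same] at h1
  linarith

theorem qe_mem (θ : E.Types) : E.qe θ ∈ Set.Icc 0 E.qbar := (E.qe_spec θ).1

theorem P_qe (θ : E.Types) : E.P (E.qe θ) = θ := (E.qe_spec θ).2

theorem qe_antitone : Antitone E.qe := fun s t hst =>
  (E.P_strictAnti.le_iff_ge (E.qe_mem s) (E.qe_mem t)).1 (by rw [E.P_qe, E.P_qe]; exact hst)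

/-- The highest type has the smallest efficient quantity. There `surplus_pos` makes `V q - q P(q)`
exceed `c`, its value at `q̂`, and this function is monotone. -/
theorem qhat_le_qe (θ : E.Types) : E.qhat ≤ E.qe θ := by
  obtain ⟨q, hq, hP, hpos⟩ := E.surplus_pos
  have h1 : q ≤ E.qe θ :=
    (E.P_strictAnti.le_iff_ge (E.qe_mem θ) hq).1 (by rw [E.P_qe, hP]; exact θ.2.2)
  refine le_trans ?_ h1
  by_contra! h
  have h2 := E.consumerSurplus_mono hq E.qhat_mem h.le
  rw [E.qhat_spec.2, hP] at h2
  change 0 < E.V q - E.c - E.θhi * q at hpos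
  linarith

/-! ### The concave envelope -/

/-- The largest expected gross surplus, net of the fixed cost, at a given expected quantity. -/
def envelope (x : ℝ) : ℝ := E.P E.qhat * min x E.qhat + (E.V (max x E.qhat) - E.V E.qhat)

theorem envelope_of_le {x : ℝ} (hx : x ≤ E.qhat) : E.envelope x = E.P E.qhat * x := by
  simp [envelope, min_eq_left hx, max_eq_right hx]

theorem envelope_of_ge {x : ℝ} (hx : E.qhat ≤ x) : E.envelope x = E.V x - E.c := by
  have := E.qhat_spec.2
  rw [envelope, min_eq_right hx, max_eq_left hx]; linarith

theorem max_qhat_mem {x : ℝ} (hx : x ∈ Set.Icc 0 E.qbar) : max x E.qhat ∈ Set.Icc 0 E.qbar :=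
  ⟨hx.1.trans (le_max_left _ _), max_le hx.2 E.qhat_mem.2⟩

theorem envelope_monotoneOn : MonotoneOn E.envelope (Set.Icc 0 E.qbar) := by
  intro x hx y hy hxy
  have h1 := mul_le_mul_of_nonneg_left (min_le_min_right E.qhat hxy) (E.P_nonneg E.qhat_mem)
  have h2 := E.V_mono (E.max_qhat_mem hx) (E.max_qhat_mem hy) (max_le_max_right E.qhat hxy)
  simp only [envelope]; linarith

theorem envelope_continuousOn : ContinuousOn E.envelope (Set.Icc 0 E.qbar) := by
  have h : ContinuousOn (fun x => E.V (max x E.qhat)) (Set.Icc 0 E.qbar) :=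
    E.V_continuousOn.comp (by fun_prop) fun x hx => E.max_qhat_mem hx
  exact ContinuousOn.add (by fun_prop) (h.sub continuousOn_const)

/-- Below the floor, compare with the tangent at `q̂`, which after subtracting `c` passes through
the origin. Above it, the tangent at `z = q * r` leaves the slack `(1 - r) * (V z - z P(z) - c)`,
nonnegative because `z ≥ q̂`. -/
theorem mul_le_envelope {q r : ℝ} (hq : q ∈ Set.Icc 0 E.qbar) (hr : r ∈ Set.Icc (0 : ℝ) 1) :
    r * (E.V q - E.c) ≤ E.envelope (q * r) := by
  have hc := E.qhat_spec.2
  rcases le_total (q * r) E.qhat with h | h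
  · rw [E.envelope_of_le h]
    have := mul_le_mul_of_nonneg_left (E.V_le_tangent E.qhat_mem hq) hr.1
    rw [← hc]
    linarith
  · have hz : q * r ∈ Set.Icc 0 E.qbar :=
      ⟨mul_nonneg hq.1 hr.1, (mul_le_of_le_one_right hq.1 hr.2).trans hq.2⟩
    rw [E.envelope_of_ge h]
    have h1 := mul_le_mul_of_nonneg_left (E.V_le_tangent hz hq) hr.1
    have h2 := E.consumerSurplus_mono E.qhat_mem hz h
    have h3 := mul_nonneg (sub_nonneg.2 hr.2) (sub_nonneg.2 h2)
    rw [hc] at h3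
    nlinarith

/-- The envelope has slope `P q̂ ≥ θ` up to the floor, and its tangent at `qe θ` has slope exactly
`θ`. -/
theorem envelope_sub_le_qe (θ : E.Types) {x : ℝ} (hx : x ∈ Set.Icc 0 E.qbar) :
    E.envelope x - θ * x ≤ E.envelope (E.qe θ) - θ * E.qe θ := by
  have hc := E.qhat_spec.2
  rw [E.envelope_of_ge (E.qhat_le_qe θ)]
  rcases le_total x E.qhat with h | h
  · rw [E.envelope_of_le h]
    have h1 := E.V_le_tangent (E.qe_mem θ) E.qhat_mem
    have h2 := E.P_strictAnti.antitoneOn E.qhat_mem (E.qe_mem θ) (E.qhat_le_qe θ)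
    rw [E.P_qe] at h1 h2
    have h3 := mul_le_mul_of_nonneg_right h (sub_nonneg.2 h2)
    linarith
  · rw [E.envelope_of_ge h]
    have h1 := E.V_le_tangent (E.qe_mem θ) hx
    rw [E.P_qe] at h1
    linarith

/-! ### Schedules and information rents -/

/-- Lebesgue measure on the type space. -/
def typeMeasure : Measure E.Types := Measure.comap Subtype.val volume

theorem typeMeasure_apply (s : Set E.Types) :
    E.typeMeasure s = volume ((fun t : E.Types => (t : ℝ)) '' s) :=
  comap_subtype_coe_apply measurableSet_Icc _ _

instance : IsFiniteMeasure E.typeMeasure := by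
  refine ⟨?_⟩
  rw [typeMeasure_apply, Set.image_univ, Subtype.range_coe]
  exact measure_Icc_lt_top

theorem typeMeasure_real_Ioc {a b : E.Types} (hab : a ≤ b) :
    E.typeMeasure.real (Set.Ioc a b) = b - a := by
  have : (fun t : E.Types => (t : ℝ)) '' Set.Ioc a b = Set.Ioc (a : ℝ) b := by
    ext y
    constructor
    · rintro ⟨t, ht, rfl⟩; exact ht
    · intro hy
      exact ⟨⟨y, a.2.1.trans hy.1.le, hy.2.trans b.2.2⟩, hy, rfl⟩
  rw [measureReal_def, typeMeasure_apply, this, ← measureReal_def, Real.volume_real_Ioc_of_le hab]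

/-- An expected quantity schedule that can be part of an incentive compatible mechanism. -/
structure IsSchedule (x : E.Types → ℝ) : Prop where
  anti : Antitone x
  mem : ∀ θ, x θ ∈ Set.Icc 0 E.qbar

variable {E}

namespace IsSchedule

variable {x : E.Types → ℝ} (hx : E.IsSchedule x)
include hx

theorem abs_le (θ : E.Types) : |x θ| ≤ E.qbar := by
  rw [abs_of_nonneg (hx.mem θ).1]; exact (hx.mem θ).2

theorem integrable (μ : Measure E.Types) [IsFiniteMeasure μ] : Integrable x μ :=
  Integrable.of_bound hx.anti.measurable.aestronglyMeasurable E.qbar (Eventually.of_forall hx.abs_le)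

end IsSchedule

/-- The information rent that implements a quantity schedule, leaving nothing to the highest
type. -/
def rent (x : E.Types → ℝ) (θ : E.Types) : ℝ := ∫ t in Set.Ioi θ, x t ∂E.typeMeasure

namespace IsSchedule

variable {x : E.Types → ℝ}

theorem rent_sub (hx : E.IsSchedule x) {a b : E.Types} (hab : a ≤ b) :
    rent x a - rent x b = ∫ t in Set.Ioc a b, x t ∂E.typeMeasure := by
  have hi := hx.integrable E.typeMeasure
  rw [rent, rent, ← Set.Ioc_union_Ioi_eq_Ioi hab, setIntegral_union
    (Set.Ioc_disjoint_Ioi le_rfl) measurableSet_Ioi hi.integrableOn hi.integrableOn]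
  ring

/-- With `rent_sub_le`, this gives both directions of incentive compatibility: an antitone `x`
averages between its endpoint values. -/
theorem le_rent_sub (hx : E.IsSchedule x) {a b : E.Types} (hab : a ≤ b) :
    (b - a) * x b ≤ rent x a - rent x b := by
  rw [hx.rent_sub hab, ← E.typeMeasure_real_Ioc hab, ← smul_eq_mul, ← setIntegral_const]
  exact setIntegral_mono_on (integrable_const _) (hx.integrable _).integrableOn measurableSet_Ioc
    fun t ht => hx.anti ht.2

theorem rent_sub_le (hx : E.IsSchedule x) {a b : E.Types} (hab : a ≤ b) :
    rent x a - rent x b ≤ (b - a) * x a := by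
  rw [hx.rent_sub hab, ← E.typeMeasure_real_Ioc hab, ← smul_eq_mul, ← setIntegral_const]
  exact setIntegral_mono_on (hx.integrable _).integrableOn (integrable_const _) measurableSet_Ioc
    fun t ht => hx.anti ht.1.le

theorem rent_nonneg (hx : E.IsSchedule x) (θ : E.Types) : 0 ≤ rent x θ :=
  integral_nonneg fun t => (hx.mem t).1

theorem rent_antitone (hx : E.IsSchedule x) : Antitone (rent x) := fun a b hab => by
  have := hx.le_rent_sub hab
  have h2 := mul_nonneg (sub_nonneg.2 (show (a : ℝ) ≤ b from hab)) (hx.mem b).1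
  linarith

/-- Comparing only strictly above `θ` allows a schedule to be raised at the lowest type without
raising any rent. -/
theorem rent_mono (hx : E.IsSchedule x) {y : E.Types → ℝ} (hy : E.IsSchedule y) (θ : E.Types)
    (h : ∀ t, θ < t → y t ≤ x t) : rent y θ ≤ rent x θ :=
  setIntegral_mono_on (hy.integrable _).integrableOn (hx.integrable _).integrableOn
    measurableSet_Ioi h

theorem rent_top (x : E.Types → ℝ) {θ : E.Types} (hθ : (θ : ℝ) = E.θhi) : rent x θ = 0 := by
  have : Set.Ioi θ = ∅ := by
    ext t
    simpa using Subtype.coe_le_coe.1 (t.2.2.trans_eq hθ.symm)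
  rw [rent, this, Measure.restrict_empty, integral_zero_measure]

/-- A type that never operates cannot be paid, so implementation requires that its rent vanish. -/
theorem rent_eq_zero (hx : E.IsSchedule x) {θ : E.Types} (h : x θ = 0) : rent x θ = 0 := by
  refine setIntegral_eq_zero_of_forall_eq_zero fun t ht => ?_
  exact le_antisymm ((hx.anti (le_of_lt ht)).trans_eq h) (hx.mem t).1

theorem envelope_antitone (hx : E.IsSchedule x) : Antitone fun θ => E.envelope (x θ) :=
  fun _ _ hab => E.envelope_monotoneOn (hx.mem _) (hx.mem _) (hx.anti hab)

end IsSchedule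

variable (E) in
theorem integrable_of_antitone {f : E.Types → ℝ} (hf : Antitone f) (μ : Measure E.Types)
    [IsFiniteMeasure μ] : Integrable f μ := by
  have hlo : ∀ θ : E.Types, (⟨E.θlo, le_rfl, E.θlo_lt_θhi.le⟩ : E.Types) ≤ θ := fun θ => θ.2.1
  have hhi : ∀ θ : E.Types, θ ≤ (⟨E.θhi, E.θlo_lt_θhi.le, le_rfl⟩ : E.Types) := fun θ => θ.2.2
  exact Integrable.of_mem_Icc _ _ hf.measurable.aemeasurable
    (Eventually.of_forall fun θ => ⟨hf (hhi θ), hf (hlo θ)⟩)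

/-- The regulator's surplus from a schedule implemented at the lowest possible rent. -/
def objective (α : ℝ) (x : E.Types → ℝ) (θ : E.Types) : ℝ :=
  E.envelope (x θ) - θ * x θ - (1 - α) * rent x θ

theorem IsSchedule.integrable_mul {x : E.Types → ℝ} (hx : E.IsSchedule x) (μ : Measure E.Types)
    [IsFiniteMeasure μ] : Integrable (fun θ : E.Types => (θ : ℝ) * x θ) μ := by
  refine (hx.integrable μ).bdd_mul (c := E.θhi) measurable_subtype_coe.aestronglyMeasurable ?_
  refine Eventually.of_forall fun θ => ?_
  rw [Real.norm_of_nonneg (E.θlo_pos.le.trans θ.2.1)]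
  exact θ.2.2

theorem IsSchedule.integrable_objective {x : E.Types → ℝ} (hx : E.IsSchedule x) (α : ℝ)
    (μ : Measure E.Types) [IsFiniteMeasure μ] : Integrable (objective α x) μ :=
  ((E.integrable_of_antitone hx.envelope_antitone μ).sub (hx.integrable_mul μ)).sub
    ((E.integrable_of_antitone hx.rent_antitone μ).const_mul _)

/-! ### Upper bound on the surplus of a mechanism -/

/-- The expected quantity produced by each reported type. -/
def Mechanism.schedule (M : E.Mechanism) (θ : E.Types) : ℝ := M.q θ * M.r θ

namespace Mechanism

variable {M : E.Mechanism}

theorem IC.le_u_sub (h : M.IC) (θ θ' : E.Types) :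
    ((θ' : ℝ) - θ) * M.schedule θ' ≤ M.u θ - M.u θ' := by
  have := h θ θ'
  simp only [u, payoff, schedule] at this ⊢
  linarith

theorem IC.isSchedule (h : M.IC) : E.IsSchedule M.schedule where
  anti a b hab := by
    rcases hab.eq_or_lt with rfl | hlt
    · rfl
    have h1 := h.le_u_sub a b
    have h2 := h.le_u_sub b a
    have h3 : (0 : ℝ) < b - a := sub_pos.2 hlt
    by_contra! h4
    nlinarith
  mem θ := ⟨mul_nonneg (M.q_mem θ).1 (M.r_mem θ).1,
    (mul_le_of_le_one_right (M.q_mem θ).1 (M.r_mem θ).2).trans (M.q_mem θ).2⟩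

/-- An envelope theorem without derivatives: on `[s, t]` both `u` and the rent fall by an amount
between `(t - s) * x t` and `(t - s) * x s`. Thus `u - rent` does not increase, and at the highest
type it is nonnegative by IR. -/
theorem IC.rent_le_u (h : M.IC) (hIR : M.IR) (θ : E.Types) : rent M.schedule θ ≤ M.u θ := by
  have hx := h.isSchedule
  set top : E.Types := ⟨E.θhi, E.θlo_lt_θhi.le, le_rfl⟩ with htop
  set p := Set.projIcc E.θlo E.θhi E.θlo_lt_θhi.le with hp
  have key := le_of_forall_sub_le_mul (a := θ) (b := top)
    (F := fun t => M.u (p t) - rent M.schedule (p t)) (g := fun t => M.schedule (p t)) θ.2.2 (by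
      intro s hs t ht hst
      have hs' : s ∈ Set.Icc E.θlo E.θhi := ⟨θ.2.1.trans hs.1, hs.2⟩
      have ht' : t ∈ Set.Icc E.θlo E.θhi := ⟨θ.2.1.trans ht.1, ht.2⟩
      simp only [hp, Set.projIcc_of_mem _ hs', Set.projIcc_of_mem _ ht']
      have h1 := h.le_u_sub ⟨s, hs'⟩ ⟨t, ht'⟩
      have h2 := hx.rent_sub_le (a := ⟨s, hs'⟩) (b := ⟨t, ht'⟩) hst
      simp only at h1 h2
      linarith)
  simp only [hp, Set.projIcc_val] at key
  rw [IsSchedule.rent_top M.schedule (θ := top) rfl] at key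
  have := hIR top
  linarith

theorem RS_eq (M : E.Mechanism) (α : ℝ) (θ : E.Types) :
    M.RS α θ = M.r θ * (E.V (M.q θ) - E.c) - θ * M.schedule θ - (1 - α) * M.u θ := by
  simp only [RS, CS, u, payoff, schedule]; ring

theorem RS_le_objective {α : ℝ} (hα : α ≤ 1) (h : M.IC) (hIR : M.IR) (θ : E.Types) :
    M.RS α θ ≤ objective α M.schedule θ := by
  have h1 := E.mul_le_envelope (M.q_mem θ) (M.r_mem θ)
  have h2 := mul_le_mul_of_nonneg_left (h.rent_le_u hIR θ) (sub_nonneg.2 hα)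
  rw [RS_eq, objective]
  change _ ≤ E.envelope (M.schedule θ) at h1
  linarith

end Mechanism

/-! ### Deterministic implementation of a schedule -/

/-- The schedule never prescribes a positive quantity below the floor. -/
def IsFloored (x : E.Types → ℝ) : Prop := ∀ θ, x θ = 0 ∨ E.qhat ≤ x θ

open Classical in
/-- The deterministic mechanism implementing a schedule at the lowest possible rent. -/
def Mechanism.ofSchedule (x : E.Types → ℝ) (hx : ∀ θ, x θ ∈ Set.Icc 0 E.qbar) : E.Mechanism where
  r θ := if x θ = 0 then 0 else 1
  q := x
  -- The subsidy offsets the loss of an operating truthful type and adds exactly its rent.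
  s θ := rent x θ - x θ * E.P (x θ) + E.c + θ * x θ
  r_mem θ := by split_ifs <;> simp
  q_mem := hx
  q_eq_zero_iff θ := by split_ifs with h <;> simp [h]

namespace IsSchedule

variable {x : E.Types → ℝ} (hx : E.IsSchedule x)
include hx

theorem ofSchedule_payoff (θ θ' : E.Types) :
    (Mechanism.ofSchedule x hx.mem).payoff θ θ' = rent x θ' + (θ' - θ) * x θ' := by
  by_cases h : x θ' = 0
  · simp [Mechanism.payoff, Mechanism.ofSchedule, h, hx.rent_eq_zero h]
  · simp only [Mechanism.payoff, Mechanism.ofSchedule, h, if_false]; ring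

theorem ofSchedule_u (θ : E.Types) : (Mechanism.ofSchedule x hx.mem).u θ = rent x θ := by
  rw [Mechanism.u, hx.ofSchedule_payoff]; ring

theorem ofSchedule_IC : (Mechanism.ofSchedule x hx.mem).IC := by
  intro θ θ'
  rw [hx.ofSchedule_payoff, hx.ofSchedule_u]
  rcases le_total θ θ' with h | h
  · linarith [hx.le_rent_sub h]
  · linarith [hx.rent_sub_le h]

theorem ofSchedule_IR : (Mechanism.ofSchedule x hx.mem).IR := fun θ => by
  rw [hx.ofSchedule_u]; exact hx.rent_nonneg θ

/-- At zero and from `q̂` on, the envelope is the surplus actually generated, so nothing is lost in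
`RS_le_objective`. -/
theorem ofSchedule_RS (hf : IsFloored x) (α : ℝ) :
    (Mechanism.ofSchedule x hx.mem).RS α = objective α x := by
  funext θ
  rw [Mechanism.RS_eq, hx.ofSchedule_u, objective]
  rcases hf θ with h | h
  · simp [Mechanism.schedule, Mechanism.ofSchedule, h, E.envelope_of_le E.qhat_mem.1]
  · have h0 : x θ ≠ 0 := (E.qhat_pos.trans_le h).ne'
    simp [Mechanism.schedule, Mechanism.ofSchedule, h0, E.envelope_of_ge h]

end IsSchedule

/-! ### Removing random operation -/

variable {α : ℝ} {x : E.Types → ℝ}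

theorem IsSchedule.min_const (hx : E.IsSchedule x) {K : ℝ} (hK : 0 ≤ K) :
    E.IsSchedule fun θ => min (x θ) K where
  anti _ _ hab := min_le_min_right K (hx.anti hab)
  mem θ := ⟨le_min (hx.mem θ).1 hK, (min_le_left _ _).trans (hx.mem θ).2⟩

theorem IsSchedule.max_qhat (hx : E.IsSchedule x) : E.IsSchedule fun θ => max (x θ) E.qhat where
  anti _ _ hab := max_le_max_right E.qhat (hx.anti hab)
  mem θ := E.max_qhat_mem (hx.mem θ)

theorem measurable_measureReal_Iio (G : Measure E.Types) [IsFiniteMeasure G] :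
    Measurable fun t : E.Types => G.real (Set.Iio t) :=
  (show Monotone fun t : E.Types => G.real (Set.Iio t) from
    fun _ _ hab => measureReal_mono (Set.Iio_subset_Iio hab)).measurable

theorem abs_measureReal_Iio_le (G : Measure E.Types) [IsProbabilityMeasure G] (t : E.Types) :
    |G.real (Set.Iio t)| ≤ 1 := by
  rw [abs_of_nonneg measureReal_nonneg]; exact measureReal_le_one

theorem integrable_virtualWeight_mul (hx : E.IsSchedule x) (α : ℝ) (G : Measure E.Types)
    [IsProbabilityMeasure G] :
    Integrable (fun t => -(1 - α) * G.real (Set.Iio t) * x t) E.typeMeasure := by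
  simp_rw [mul_assoc]
  exact ((hx.integrable _).bdd_mul (c := 1) (measurable_measureReal_Iio G).aestronglyMeasurable
    (Eventually.of_forall (abs_measureReal_Iio_le G))).const_mul _

/-- By Fubini: the quantity at `t` enters the rent of every type strictly below `t`. No density of
`G` is needed, and atoms are allowed. -/
theorem IsSchedule.integral_rent (hx : E.IsSchedule x) (G : Measure E.Types)
    [IsProbabilityMeasure G] :
    ∫ θ, rent x θ ∂G = ∫ t, G.real (Set.Iio t) * x t ∂E.typeMeasure := by
  have h1 : ∀ θ, rent x θ = ∫ t, (if θ < t then x t else 0) ∂E.typeMeasure := by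
    intro θ
    rw [rent, ← integral_indicator measurableSet_Ioi]
    simp [Set.indicator_apply]
  simp_rw [h1]
  rw [integral_integral_swap]
  · refine integral_congr_ae (Eventually.of_forall fun t => ?_)
    have h2 : (fun θ => if θ < t then x t else 0) = (Set.Iio t).indicator fun _ => x t := by
      funext θ; simp [Set.indicator_apply]
    simp only
    rw [h2, integral_indicator_const _ measurableSet_Iio, smul_eq_mul]
  · refine Integrable.of_bound (C := E.qbar) (Measurable.aestronglyMeasurable ?_)
      (Eventually.of_forall fun p => ?_)
    · exact Measurable.ite (measurableSet_lt measurable_fst measurable_snd)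
        (hx.anti.measurable.comp measurable_snd) measurable_const
    · simp only [Function.uncurry, Real.norm_eq_abs]
      split_ifs
      · exact hx.abs_le _
      · simpa using E.qbar_pos.le

/-- The expected surplus is the sum of a linear functional of the part of the schedule below the
floor and a functional of the part above it. -/
theorem IsSchedule.integral_objective (hx : E.IsSchedule x) (α : ℝ) (G : Measure E.Types)
    [IsProbabilityMeasure G] :
    ∫ θ, objective α x θ ∂G =
      ((∫ θ, (E.P E.qhat - θ) * min (x θ) E.qhat ∂G) +
        ∫ t, (-(1 - α) * G.real (Set.Iio t)) * min (x t) E.qhat ∂E.typeMeasure) +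
      ((∫ θ, (E.V (max (x θ) E.qhat) - E.V E.qhat - θ * (max (x θ) E.qhat - E.qhat)) ∂G) +
        ∫ t, (-(1 - α) * G.real (Set.Iio t)) * (max (x t) E.qhat - E.qhat) ∂E.typeMeasure) := by
  have hmin := hx.min_const E.qhat_pos.le
  have hmax := hx.max_qhat
  have hq : E.IsSchedule fun _ => E.qhat := ⟨antitone_const, fun _ => E.qhat_mem⟩
  have hsplit : ∀ θ, x θ = min (x θ) E.qhat + (max (x θ) E.qhat - E.qhat) := fun θ => by
    have := min_add_max (x θ) E.qhat; linarith
  have hV : Integrable (fun θ => E.V (max (x θ) E.qhat)) G :=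
    E.integrable_of_antitone (fun a b hab =>
      E.V_mono (hmax.mem b) (hmax.mem a) (hmax.anti hab)) G
  have i1 : Integrable (fun θ : E.Types => (E.P E.qhat - θ) * min (x θ) E.qhat) G := by
    simp_rw [sub_mul]
    exact ((hmin.integrable G).const_mul _).sub (hmin.integrable_mul G)
  have i2 : Integrable (fun θ : E.Types =>
      E.V (max (x θ) E.qhat) - E.V E.qhat - θ * (max (x θ) E.qhat - E.qhat)) G := by
    simp_rw [mul_sub]
    exact (hV.sub (integrable_const _)).sub ((hmax.integrable_mul G).sub (hq.integrable_mul G))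
  have i3 : Integrable (rent x) G := E.integrable_of_antitone hx.rent_antitone G
  have i4 := integrable_virtualWeight_mul hmin α G
  have i5 : Integrable (fun t => -(1 - α) * G.real (Set.Iio t) * (max (x t) E.qhat - E.qhat))
      E.typeMeasure := by
    simp_rw [mul_sub]
    exact (integrable_virtualWeight_mul hmax α G).sub (integrable_virtualWeight_mul hq α G)
  have e1 : ∀ θ, objective α x θ = (E.P E.qhat - θ) * min (x θ) E.qhat +
      (E.V (max (x θ) E.qhat) - E.V E.qhat - θ * (max (x θ) E.qhat - E.qhat)) +
      -(1 - α) * rent x θ := fun θ => by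
    rw [objective, envelope]
    linear_combination (-(θ : ℝ)) * hsplit θ
  have e2 : -(1 - α) * ∫ θ, rent x θ ∂G =
      (∫ t, -(1 - α) * G.real (Set.Iio t) * min (x t) E.qhat ∂E.typeMeasure) +
      ∫ t, -(1 - α) * G.real (Set.Iio t) * (max (x t) E.qhat - E.qhat) ∂E.typeMeasure := by
    rw [hx.integral_rent, ← integral_const_mul, ← integral_add i4 i5]
    refine integral_congr_ae (Eventually.of_forall fun t => ?_)
    simp only
    linear_combination (-(1 - α) * G.real (Set.Iio t)) * hsplit t
  simp_rw [e1]
  rw [integral_add (by exact i1.add i2) (i3.const_mul _), integral_add i1 i2, integral_const_mul, e2]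
  ring

/-- Random operation can be replaced by a deterministic threshold rule. -/
theorem IsSchedule.exists_isFloored (hx : E.IsSchedule x) (α : ℝ) (G : Measure E.Types)
    [IsProbabilityMeasure G] :
    ∃ y, E.IsSchedule y ∧ IsFloored y ∧
      ∫ θ, objective α x θ ∂G ≤ ∫ θ, objective α y θ ∂G := by
  obtain ⟨s, hs, hle⟩ := exists_threshold_ge G E.typeMeasure
    (w := fun θ : E.Types => E.P E.qhat - θ) (v := fun t => -(1 - α) * G.real (Set.Iio t))
    (C := |E.P E.qhat| + E.θhi) (D := |-(1 - α)| * 1)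
    (measurable_const.sub measurable_subtype_coe)
    (fun θ => (abs_sub _ _).trans (by
      rw [abs_of_nonneg (E.θlo_pos.le.trans θ.2.1)]; exact add_le_add_right θ.2.2 _))
    ((measurable_measureReal_Iio G).const_mul _)
    (fun t => by
      rw [abs_mul]
      exact mul_le_mul_of_nonneg_left (abs_measureReal_Iio_le G t) (abs_nonneg _))
    hx.anti.measurable (fun θ => (hx.mem θ).1) E.qhat_pos
  -- This replaces the part below the floor by the threshold rule and keeps the part above it.
  set y : E.Types → ℝ := fun θ => if s < x θ then max (x θ) E.qhat else 0 with hy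
  have hys : E.IsSchedule y := by
    refine ⟨fun a b hab => ?_, fun θ => ?_⟩
    · simp only [hy]
      by_cases h : s < x b
      · rw [if_pos h, if_pos (h.trans_le (hx.anti hab))]
        exact max_le_max_right _ (hx.anti hab)
      · rw [if_neg h]
        split_ifs
        · exact (E.max_qhat_mem (hx.mem a)).1
        · exact le_rfl
    · simp only [hy]
      split_ifs
      · exact E.max_qhat_mem (hx.mem θ)
      · exact E.zero_mem
  have hmin : ∀ θ, min (y θ) E.qhat = if s < x θ then E.qhat else 0 := by
    intro θ
    simp only [hy]
    split_ifs
    · exact min_eq_right (le_max_right _ _)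
    · exact min_eq_left E.qhat_pos.le
  have hmax : ∀ θ, max (y θ) E.qhat = max (x θ) E.qhat := by
    intro θ
    simp only [hy]
    split_ifs with h
    · exact max_eq_left (le_max_right _ _)
    -- Here `s < q̂` matters: types shut down had quantity below the floor, so their upper part was
    -- already zero.
    · rw [max_eq_right E.qhat_pos.le, max_eq_right ((not_lt.1 h).trans hs.2.le)]
  refine ⟨y, hys, fun θ => ?_, ?_⟩
  · simp only [hy]
    split_ifs
    · exact Or.inr (le_max_right _ _)
    · exact Or.inl rfl
  · rw [hx.integral_objective, hys.integral_objective]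
    simp_rw [hmin, hmax]
    exact add_le_add_left hle _

/-! ### Downward distortion -/

/-- The schedules with the structural properties of an optimal deterministic mechanism. -/
structure IsRegular (x : E.Types → ℝ) : Prop extends E.IsSchedule x where
  floored : IsFloored x
  le_qe : ∀ θ, x θ ≤ E.qe θ
  eq_qe : ∀ θ : E.Types, (θ : ℝ) = E.θlo → x θ = E.qe θ

theorem isRegular_qe : IsRegular E.qe where
  anti := E.qe_antitone
  mem := E.qe_mem
  floored θ := Or.inr (E.qhat_le_qe θ)
  le_qe _ := le_rfl
  eq_qe _ _ := rfl

/-- Distorting a schedule down to the efficient quantity, and removing the distortion at the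
lowest type, does not hurt the regulator. -/
theorem IsSchedule.exists_isRegular (hx : E.IsSchedule x) (hf : IsFloored x) (hα : α ≤ 1) :
    ∃ y, IsRegular y ∧ ∀ θ, objective α x θ ≤ objective α y θ := by
  classical
  -- Setting the lowest type to its efficient quantity is free, since no rent integrates over that
  -- type.
  set y : E.Types → ℝ := fun θ => if (θ : ℝ) = E.θlo then E.qe θ else min (x θ) (E.qe θ) with hy
  have hle : ∀ θ, y θ ≤ E.qe θ := fun θ => by
    simp only [hy]; split_ifs
    · exact le_rfl
    · exact min_le_right _ _
  have hys : E.IsSchedule y := by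
    refine ⟨fun a b hab => ?_, fun θ => ?_⟩
    · by_cases ha : (a : ℝ) = E.θlo
      · exact (hle b).trans ((E.qe_antitone hab).trans_eq (if_pos ha).symm)
      · have hb : (b : ℝ) ≠ E.θlo := fun hb => ha (le_antisymm (hb ▸ hab) a.2.1)
        simp only [hy, if_neg ha, if_neg hb]
        exact min_le_min (hx.anti hab) (E.qe_antitone hab)
    · simp only [hy]; split_ifs
      · exact E.qe_mem θ
      · exact ⟨le_min (hx.mem θ).1 (E.qe_mem θ).1, (min_le_left _ _).trans (hx.mem θ).2⟩
  refine ⟨y, ⟨hys, fun θ => ?_, hle, fun θ h => if_pos h⟩, fun θ => ?_⟩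
  · simp only [hy]; split_ifs
    · exact Or.inr (E.qhat_le_qe θ)
    · rcases hf θ with h | h
      · exact Or.inl (by rw [h, min_eq_left (E.qe_mem θ).1])
      · exact Or.inr (le_min h (E.qhat_le_qe θ))
  · have h1 : rent y θ ≤ rent x θ := hx.rent_mono hys θ fun t ht => by
      have : (t : ℝ) ≠ E.θlo := fun h => (θ.2.1.trans_lt (show (θ : ℝ) < t from ht)).ne' h
      simp only [hy, if_neg this]
      exact min_le_left _ _
    have h2 := mul_le_mul_of_nonneg_left h1 (sub_nonneg.2 hα)
    have h3 := E.envelope_sub_le_qe θ (hx.mem θ)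
    have h4 : E.envelope (x θ) - θ * x θ ≤ E.envelope (y θ) - θ * y θ := by
      simp only [hy]; split_ifs
      · exact h3
      · rcases min_choice (x θ) (E.qe θ) with h | h <;> rw [h]
        exact h3
    simp only [objective]
    linarith

/-! ### Existence of an optimal regular schedule -/

theorem IsSchedule.rent_le (hx : E.IsSchedule x) (θ : E.Types) :
    rent x θ ≤ (E.θhi - E.θlo) * E.qbar := by
  have htop : E.θhi ∈ Set.Icc E.θlo E.θhi := ⟨E.θlo_lt_θhi.le, le_rfl⟩
  have h := hx.rent_sub_le (a := θ) (b := ⟨E.θhi, htop⟩) θ.2.2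
  rw [rent_top x (θ := ⟨E.θhi, htop⟩) rfl, sub_zero] at h
  exact h.trans (mul_le_mul (sub_le_sub_left θ.2.1 _) (hx.mem θ).2 (hx.mem θ).1
    (sub_nonneg.2 E.θlo_lt_θhi.le))

/-- The bound is uniform over schedules: it makes the supremum finite and dominates the limit. -/
theorem IsSchedule.abs_objective_le (hx : E.IsSchedule x) (hα : α ≤ 1) (θ : E.Types) :
    |objective α x θ| ≤
      E.envelope E.qbar + E.θhi * E.qbar + (1 - α) * ((E.θhi - E.θlo) * E.qbar) := by
  have hα' := sub_nonneg.2 hα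
  have h1 := E.envelope_monotoneOn (hx.mem θ) ⟨E.qbar_pos.le, le_rfl⟩ (hx.mem θ).2
  have h2 := E.envelope_monotoneOn E.zero_mem (hx.mem θ) (hx.mem θ).1
  rw [E.envelope_of_le E.qhat_mem.1, mul_zero] at h2
  have h3 := mul_le_mul_of_nonneg_left (hx.rent_le θ) hα'
  have h4 := mul_nonneg hα' (hx.rent_nonneg θ)
  have hθ := E.θlo_pos.le.trans θ.2.1
  have h5 := mul_nonneg hθ (hx.mem θ).1
  have h6 := mul_le_mul θ.2.2 (hx.mem θ).2 (hx.mem θ).1 (hθ.trans θ.2.2)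
  rw [objective, _root_.abs_le]
  constructor <;> linarith

theorem IsSchedule.of_tendsto {z : ℕ → E.Types → ℝ} (hz : ∀ n, E.IsSchedule (z n))
    (h : ∀ θ, Tendsto (fun n => z n θ) atTop (𝓝 (x θ))) : E.IsSchedule x where
  anti a b hab := le_of_tendsto_of_tendsto' (h b) (h a) fun n => (hz n).anti hab
  mem θ := isClosed_Icc.mem_of_tendsto (h θ) (Eventually.of_forall fun n => (hz n).mem θ)

/-- Every condition is closed and concerns values at one or two types, so convergence at every type,
not merely almost everywhere, preserves it. -/
theorem IsRegular.of_tendsto {z : ℕ → E.Types → ℝ} (hz : ∀ n, IsRegular (z n))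
    (h : ∀ θ, Tendsto (fun n => z n θ) atTop (𝓝 (x θ))) : IsRegular x where
  toIsSchedule := IsSchedule.of_tendsto (fun n => (hz n).toIsSchedule) h
  floored θ := (isClosed_singleton.union isClosed_Ici :
    IsClosed ({0} ∪ Set.Ici E.qhat)).mem_of_tendsto (h θ)
      (Eventually.of_forall fun n => (hz n).floored θ)
  le_qe θ := le_of_tendsto' (h θ) fun n => (hz n).le_qe θ
  eq_qe θ hθ := tendsto_nhds_unique (h θ)
    (tendsto_const_nhds.congr fun n => ((hz n).eq_qe θ hθ).symm)

theorem tendsto_objective {z : ℕ → E.Types → ℝ} (hz : ∀ n, E.IsSchedule (z n))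
    (h : ∀ θ, Tendsto (fun n => z n θ) atTop (𝓝 (x θ))) (α : ℝ) (θ : E.Types) :
    Tendsto (fun n => objective α (z n) θ) atTop (𝓝 (objective α x θ)) := by
  have hx := IsSchedule.of_tendsto hz h
  have h1 : Tendsto (fun n => E.envelope (z n θ)) atTop (𝓝 (E.envelope (x θ))) :=
    (E.envelope_continuousOn _ (hx.mem θ)).tendsto.comp (tendsto_nhdsWithin_iff.2
      ⟨h θ, Eventually.of_forall fun n => (hz n).mem θ⟩)
  have h2 : Tendsto (fun n => rent (z n) θ) atTop (𝓝 (rent x θ)) :=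
    tendsto_integral_of_dominated_convergence (fun _ => E.qbar)
      (fun n => ((hz n).integrable _).aestronglyMeasurable) (integrable_const _)
      (fun n => Eventually.of_forall (hz n).abs_le) (Eventually.of_forall h)
  exact (h1.sub ((h θ).const_mul _)).sub (h2.const_mul _)

theorem exists_subseq_tendsto_schedule {z : ℕ → E.Types → ℝ} (hz : ∀ n, E.IsSchedule (z n)) :
    ∃ φ : ℕ → ℕ, StrictMono φ ∧ ∃ x : E.Types → ℝ,
      ∀ θ, Tendsto (fun n => z (φ n) θ) atTop (𝓝 (x θ)) := by
  -- Constant extension beyond the endpoints keeps the schedules antitone on the whole line.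
  obtain ⟨φ, hφ, h⟩ := exists_subseq_tendsto_of_antitone
    (fun n => Set.IccExtend E.θlo_lt_θhi.le (z n))
    (fun n => (hz n).anti.comp_monotone (Set.monotone_projIcc _)) (fun n t => (hz n).mem _)
  choose l hl using h
  refine ⟨φ, hφ, fun θ => l θ, fun θ => ?_⟩
  simpa using hl θ

theorem exists_isRegular_maximizer (hα : α ≤ 1) (G : Measure E.Types) [IsProbabilityMeasure G] :
    ∃ x : E.Types → ℝ, IsRegular x ∧ ∀ y : E.Types → ℝ, IsRegular y →
      ∫ θ, objective α y θ ∂G ≤ ∫ θ, objective α x θ ∂G := by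
  set C := E.envelope E.qbar + E.θhi * E.qbar + (1 - α) * ((E.θhi - E.θlo) * E.qbar)
  set S : Set ℝ := {v | ∃ y : E.Types → ℝ, IsRegular y ∧ ∫ θ, objective α y θ ∂G = v}
  have hne : S.Nonempty := ⟨_, E.qe, isRegular_qe, rfl⟩
  have hbdd : BddAbove S := by
    refine ⟨C, ?_⟩
    rintro _ ⟨y, hy, rfl⟩
    have := integral_mono (hy.integrable_objective α G) (integrable_const C)
      fun θ => (le_abs_self _).trans (hy.abs_objective_le hα θ)
    simpa using this
  obtain ⟨v, -, hv, hvS⟩ := exists_seq_tendsto_sSup hne hbdd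
  choose z hz hzv using hvS
  obtain ⟨φ, hφ, x, hx⟩ := exists_subseq_tendsto_schedule fun n => (hz n).toIsSchedule
  have hlim : Tendsto (fun n => ∫ θ, objective α (z (φ n)) θ ∂G) atTop
      (𝓝 (∫ θ, objective α x θ ∂G)) :=
    tendsto_integral_of_dominated_convergence (fun _ => C)
      (fun n => ((hz (φ n)).integrable_objective α G).aestronglyMeasurable) (integrable_const _)
      (fun n => Eventually.of_forall ((hz (φ n)).abs_objective_le hα))
      (Eventually.of_forall (tendsto_objective (fun n => (hz (φ n)).toIsSchedule) hx α))
  have heq : ∫ θ, objective α x θ ∂G = sSup S :=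
    tendsto_nhds_unique hlim (by simp only [hzv]; exact hv.comp hφ.tendsto_atTop)
  refine ⟨x, IsRegular.of_tendsto (fun n => hz (φ n)) hx, fun y hy => ?_⟩
  rw [heq]
  exact le_csSup hbdd ⟨y, hy, rfl⟩

end Market

end

/-! ### Optimality of the implemented maximizer -/

theorem corollary1 (E : Market) (α : ℝ) (hα : α ∈ Set.Ico (0 : ℝ) 1)
    (G : MeasureTheory.Measure E.Types) [MeasureTheory.IsProbabilityMeasure G] :
    ∃ M : E.Mechanism,
      M.Deterministic ∧ M.IsOptimal α G ∧ M.DownwardDistortion ∧ M.HasQuantityFloor := by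
  obtain ⟨x, hx, hmax⟩ := Market.exists_isRegular_maximizer hα.2.le G
  have hRS := hx.ofSchedule_RS hx.floored α
  refine ⟨Market.Mechanism.ofSchedule x hx.mem, fun θ => ?_,
    ⟨hx.ofSchedule_IC, hx.ofSchedule_IR, hRS ▸ hx.integrable_objective α G, ?_⟩,
    ⟨hx.le_qe, hx.eq_qe⟩, fun θ hθ => (hx.floored θ).resolve_left (ne_of_gt hθ)⟩
  · simp only [Market.Mechanism.ofSchedule]
    split_ifs
    · exact Or.inl rfl
    · exact Or.inr rfl
  · intro M hIC hIR hint
    have hs := hIC.isSchedule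
    obtain ⟨y, hy, hyf, hxy⟩ := hs.exists_isFloored α G
    obtain ⟨z, hz, hyz⟩ := hy.exists_isRegular hyf hα.2.le
    rw [Market.Mechanism.expectedRS, Market.Mechanism.expectedRS, hRS]
    calc ∫ θ, M.RS α θ ∂G ≤ ∫ θ, Market.objective α M.schedule θ ∂G :=
          integral_mono hint (hs.integrable_objective α G)
            (Market.Mechanism.RS_le_objective hα.2.le hIC hIR)
      _ ≤ ∫ θ, Market.objective α y θ ∂G := hxy
      _ ≤ ∫ θ, Market.objective α z θ ∂G :=
          integral_mono (hy.integrable_objective α G) (hz.integrable_objective α G) hyz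
      _ ≤ ∫ θ, Market.objective α x θ ∂G := hmax z hz
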